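/- Let $\mathbb N=\{0,1,2,\ldots\}$ and $\mathbb Z^+=\{1,2,3,\ldots\}$. (i) Any $n\in\mathbb Z^+$ can be written as $x^2+y^2+z^2+w^2$ with $x,y,z,w\in\mathbb N$ and $|2x-y|\in\{4^k:\ k\in\mathbb N\}$. (ii) Let $a\in\{1,2\}$. Then any $n\in\mathbb N$ can be written as $x^2+y^2+z^2+w^2$ with $x,y,z,w\in\mathbb N$ and $2x-y\in\{\pm a8^k:\ k\in\mathbb N\}\cup\{0\}\subseteq\{at^3:\ t\in\mathbb Z\}$. (iii) If any positive integer $n\equiv 9\pmod{20}$ can be written as $5x^2+5y^2+z^2$ with $x,y,z\in\mathbb Z$ and $2\nmid z$, then any $n\in\mathbb Z^+$ can be written as $x^2+y^2+z^2+w^2$ with $x,y,z,w\in\mathbb Z$ and $x+3y\in\{4^k:\ k\in\mathbb N\}$. -/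

import Mathlib

/-! For (i) and (ii), put m = 2x - y and s = x + 2y, so 5(x² + y²) = m² + s²: one must write 5n - m²
as s² + 5(z² + w²). By the three squares theorem this is possible for every N ≡ 0, ±1 mod 5 not of
the form 4^k(8l+7), since two of the three squares then sum to a multiple of 5
(`exists_eq_sq_add_five_mul`). One chooses m to avoid the excluded form, and scales solutions by 4
or 8 to cover the remaining n. Natural x, y require xy ≥ 0, which small m forces.

For (iii), put m = x + 3y and s = 3x - y, so 10(x² + y²) = m² + s², with u = z + w and v = z - w of
equal parity. The hypothesis is needed only for odd n.

The three squares theorem comes from reducing ternary forms of determinant 1, Dirichlet's theorem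
and quadratic reciprocity. -/

/-! ### Reduction of binary and ternary forms -/

theorem exists_abs_two_mul_add_le (B : ℤ) {A : ℤ} (hA : 0 < A) :
    ∃ t : ℤ, 2 * (B + t * A) ≤ A ∧ -A ≤ 2 * (B + t * A) := by
  refine ⟨-((2 * B + A) / (2 * A)), ?_, ?_⟩ <;>
    nlinarith [Int.emod_nonneg (2 * B + A) (by omega : 2 * A ≠ 0),
      Int.emod_lt_of_pos (2 * B + A) (by omega : 0 < 2 * A),
      Int.emod_add_mul_ediv (2 * B + A) (2 * A)]

/-- Every positive definite integral binary quadratic form `A y² + 2 B y z + C z²` is properly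
equivalent to one whose leading coefficient `A'` satisfies `3 A'² ≤ 4 (A C - B²)`. -/
theorem exists_binary_reduction (k : ℕ) : ∀ A B C : ℤ, A.toNat ≤ k → 0 < A → 0 < A * C - B ^ 2 →
    ∃ p q r s : ℤ, p * s - q * r = 1 ∧ 0 < A * p ^ 2 + 2 * B * p * q + C * q ^ 2 ∧
      3 * (A * p ^ 2 + 2 * B * p * q + C * q ^ 2) ^ 2 ≤ 4 * (A * C - B ^ 2) := by
  induction k with
  | zero => intro A B C h hA; omega
  | succ k ih =>
    intro A B C hk hA hD
    obtain ⟨t, ht1, ht2⟩ := exists_abs_two_mul_add_le B hA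
    set B' := B + t * A with hB'
    set C' := A * t ^ 2 + 2 * B * t + C with hC'
    have hdisc : A * C' - B' ^ 2 = A * C - B ^ 2 := by rw [hB', hC']; ring
    have hsq : 4 * B' ^ 2 ≤ A ^ 2 := by nlinarith
    by_cases hlt : C' < A
    · have hC'pos : 0 < C' := by nlinarith [sq_nonneg B']
      obtain ⟨p, q, r, s, h1, h2, h3⟩ := ih C' (-B') A (by omega) hC'pos (by nlinarith)
      have hval : A * (t * p - q) ^ 2 + 2 * B * (t * p - q) * p + C * p ^ 2 =
          C' * p ^ 2 + 2 * (-B') * p * q + A * q ^ 2 := by rw [hB', hC']; ring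
      refine ⟨t * p - q, p, t * r - s, r, by linarith, by rw [hval]; exact h2, ?_⟩
      rw [hval]
      linarith
    · refine ⟨1, 0, 0, 1, by norm_num, by linarith, ?_⟩
      have : A * A ≤ A * C' := mul_le_mul_of_nonneg_left (by omega) hA.le
      nlinarith

/-- The six entries of a symmetric `3 × 3` matrix form the Gram matrix of three vectors
of `ℤ³`. -/
def IsGram (a b c d e f : ℤ) : Prop :=
  ∃ u₁ u₂ u₃ v₁ v₂ v₃ w₁ w₂ w₃ : ℤ,
    a = u₁ ^ 2 + u₂ ^ 2 + u₃ ^ 2 ∧ b = v₁ ^ 2 + v₂ ^ 2 + v₃ ^ 2 ∧ c = w₁ ^ 2 + w₂ ^ 2 + w₃ ^ 2 ∧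
    d = v₁ * w₁ + v₂ * w₂ + v₃ * w₃ ∧ e = u₁ * w₁ + u₂ * w₂ + u₃ * w₃ ∧
    f = u₁ * v₁ + u₂ * v₂ + u₃ * v₃

theorem IsGram.of_swap {a b c d e f : ℤ} (h : IsGram b a c e d f) : IsGram a b c d e f := by
  obtain ⟨u₁, u₂, u₃, v₁, v₂, v₃, w₁, w₂, w₃, h1, h2, h3, h4, h5, h6⟩ := h
  exact ⟨v₁, v₂, v₃, u₁, u₂, u₃, w₁, w₂, w₃, h2, h1, h3, h5, h4, by rw [h6]; ring⟩

/-- The Gram property may be checked after adding multiples of the first basis vector to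
the other two. -/
theorem IsGram.of_shift {a b c d e f : ℤ} (t r : ℤ)
    (h : IsGram a (b + 2 * t * f + t ^ 2 * a) (c + 2 * r * e + r ^ 2 * a)
      (d + t * e + r * f + t * r * a) (e + r * a) (f + t * a)) : IsGram a b c d e f := by
  obtain ⟨u₁, u₂, u₃, v₁, v₂, v₃, w₁, w₂, w₃, h1, h2, h3, h4, h5, h6⟩ := h
  have he : e = u₁ * (w₁ - r * u₁) + u₂ * (w₂ - r * u₂) + u₃ * (w₃ - r * u₃) := by
    linear_combination h5 - r * h1
  have hf : f = u₁ * (v₁ - t * u₁) + u₂ * (v₂ - t * u₂) + u₃ * (v₃ - t * u₃) := by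
    linear_combination h6 - t * h1
  refine ⟨u₁, u₂, u₃, v₁ - t * u₁, v₂ - t * u₂, v₃ - t * u₃,
    w₁ - r * u₁, w₂ - r * u₂, w₃ - r * u₃, h1, ?_, ?_, ?_, he, hf⟩
  · linear_combination h2 - 2 * t * hf - t ^ 2 * h1
  · linear_combination h3 - 2 * r * he - r ^ 2 * h1
  · linear_combination h4 - t * he - r * hf - t * r * h1

/-- The Gram property may be checked after a unimodular change of the last two basis vectors. -/
theorem IsGram.of_unimodular {a b c d e f : ℤ} (p q r s : ℤ) (hdet : p * s - q * r = 1)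
    (h : IsGram a (b * p ^ 2 + 2 * d * p * q + c * q ^ 2) (b * r ^ 2 + 2 * d * r * s + c * s ^ 2)
      (b * p * r + d * (p * s + q * r) + c * q * s) (e * s + f * r) (e * q + f * p)) :
    IsGram a b c d e f := by
  obtain ⟨u₁, u₂, u₃, v₁, v₂, v₃, w₁, w₂, w₃, h1, h2, h3, h4, h5, h6⟩ := h
  have key : ∀ X : ℤ, X = X * (p * s - q * r) ^ 2 := fun X => by rw [hdet]; ring
  have key1 : ∀ X : ℤ, X = X * (p * s - q * r) := fun X => by rw [hdet]; ring
  refine ⟨u₁, u₂, u₃, s * v₁ - q * w₁, s * v₂ - q * w₂, s * v₃ - q * w₃,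
    p * w₁ - r * v₁, p * w₂ - r * v₂, p * w₃ - r * v₃, h1, ?_, ?_, ?_, ?_, ?_⟩
  · rw [key b]; linear_combination s ^ 2 * h2 + q ^ 2 * h3 - 2 * s * q * h4
  · rw [key c]; linear_combination r ^ 2 * h2 + p ^ 2 * h3 - 2 * p * r * h4
  · rw [key d]; linear_combination (-s * r) * h2 - p * q * h3 + (p * s + q * r) * h4
  · rw [key1 e]; linear_combination p * h5 - r * h6
  · rw [key1 f]; linear_combination s * h6 - q * h5

/-- Shifting splits off the first vector; the remaining binary form has determinant 1, so it reduces
to leading coefficient 1 and equals (y + Dz)² + z². -/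
theorem isGram_of_first_eq_one {b c d e f : ℤ} (hb : 0 < b - f ^ 2)
    (hdet : (b - f ^ 2) * (c - e ^ 2) - (d - e * f) ^ 2 = 1) : IsGram 1 b c d e f := by
  refine IsGram.of_shift (-f) (-e) ?_
  obtain ⟨p, q, r, s, h1, h2, h3⟩ := exists_binary_reduction _ (b - f ^ 2) (d - e * f) (c - e ^ 2)
    le_rfl hb (by rw [hdet]; norm_num)
  have hone : (b - f ^ 2) * p ^ 2 + 2 * (d - e * f) * p * q + (c - e ^ 2) * q ^ 2 = 1 := by
    rw [hdet] at h3; nlinarith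
  have e1 : b + 2 * -f * f + (-f) ^ 2 * 1 = b - f ^ 2 := by ring
  have e2 : c + 2 * -e * e + (-e) ^ 2 * 1 = c - e ^ 2 := by ring
  have e3 : d + -f * e + -e * f + -f * -e * 1 = d - e * f := by ring
  rw [e1, e2, e3]
  refine IsGram.of_unimodular p q r s h1 ?_
  rw [hone]
  set D := (b - f ^ 2) * p * r + (d - e * f) * (p * s + q * r) + (c - e ^ 2) * q * s with hD
  have hC : (b - f ^ 2) * r ^ 2 + 2 * (d - e * f) * r * s + (c - e ^ 2) * s ^ 2 = D ^ 2 + 1 := by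
    have : 1 = ((b - f ^ 2) * (c - e ^ 2) - (d - e * f) ^ 2) * (p * s - q * r) ^ 2 := by
      rw [hdet, h1]; norm_num
    rw [hD]
    linear_combination ((b - f ^ 2) * r ^ 2 + 2 * (d - e * f) * r * s + (c - e ^ 2) * s ^ 2) *
      (-hone) - this
  rw [hC]
  exact ⟨1, 0, 0, 0, 1, 0, 0, D, 1, by ring, by ring, by ring, by ring, by ring, by ring⟩

/-- Positive definite integral ternary forms of determinant one are sums of three squares of
linear forms. -/
theorem isGram_of_det_eq_one (k : ℕ) : ∀ a b c d e f : ℤ, a.toNat ≤ k → 0 < a →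
    0 < a * b - f ^ 2 → a * b * c + 2 * d * e * f - a * d ^ 2 - b * e ^ 2 - c * f ^ 2 = 1 →
    IsGram a b c d e f := by
  induction k with
  | zero => intro a b c d e f hk ha; omega
  | succ k ih =>
    intro a b c d e f hk ha hab hdet
    -- Completing the square in the first variable leaves this binary form, of determinant `a`.
    have hD : (a * b - f ^ 2) * (a * c - e ^ 2) - (a * d - e * f) ^ 2 = a := by
      linear_combination a * hdet
    obtain ⟨p, q, r, s, h1, h2, h3⟩ := exists_binary_reduction _ (a * b - f ^ 2) (a * d - e * f)
      (a * c - e ^ 2) le_rfl hab (by rw [hD]; exact ha)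
    rw [hD] at h3
    refine IsGram.of_unimodular p q r s h1 ?_
    have hdet' : a * (b * p ^ 2 + 2 * d * p * q + c * q ^ 2) *
        (b * r ^ 2 + 2 * d * r * s + c * s ^ 2) +
        2 * (b * p * r + d * (p * s + q * r) + c * q * s) * (e * s + f * r) * (e * q + f * p) -
        a * (b * p * r + d * (p * s + q * r) + c * q * s) ^ 2 -
        (b * p ^ 2 + 2 * d * p * q + c * q ^ 2) * (e * s + f * r) ^ 2 -
        (b * r ^ 2 + 2 * d * r * s + c * s ^ 2) * (e * q + f * p) ^ 2 = 1 := by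
      have : (a * b * c + 2 * d * e * f - a * d ^ 2 - b * e ^ 2 - c * f ^ 2) *
        (p * s - q * r) ^ 2 = 1 := by rw [hdet, h1]; norm_num
      rw [← this]; ring
    have hA : (a * b - f ^ 2) * p ^ 2 + 2 * (a * d - e * f) * p * q + (a * c - e ^ 2) * q ^ 2 =
        a * (b * p ^ 2 + 2 * d * p * q + c * q ^ 2) - (e * q + f * p) ^ 2 := by ring
    rw [hA] at h2 h3
    generalize b * p * r + d * (p * s + q * r) + c * q * s = d' at *
    generalize e * s + f * r = e' at *
    generalize e * q + f * p = f' at *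
    generalize b * p ^ 2 + 2 * d * p * q + c * q ^ 2 = b' at *
    generalize b * r ^ 2 + 2 * d * r * s + c * s ^ 2 = c' at *
    obtain ⟨t, ht1, ht2⟩ := exists_abs_two_mul_add_le f' ha
    refine IsGram.of_shift t 0 ?_
    have hA' : a * b' - f' ^ 2 = a * (b' + 2 * t * f' + t ^ 2 * a) - (f' + t * a) ^ 2 := by ring
    rw [hA'] at h2 h3
    have hdet'' : a * (b' + 2 * t * f' + t ^ 2 * a) * (c' + 2 * 0 * e' + 0 ^ 2 * a) +
        2 * (d' + t * e' + 0 * f' + t * 0 * a) * (e' + 0 * a) * (f' + t * a) -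
        a * (d' + t * e' + 0 * f' + t * 0 * a) ^ 2 -
        (b' + 2 * t * f' + t ^ 2 * a) * (e' + 0 * a) ^ 2 -
        (c' + 2 * 0 * e' + 0 ^ 2 * a) * (f' + t * a) ^ 2 = 1 := by
      rw [← hdet']; ring
    generalize d' + t * e' + 0 * f' + t * 0 * a = d at *
    generalize b' + 2 * t * f' + t ^ 2 * a = b at *
    generalize c' + 2 * 0 * e' + 0 ^ 2 * a = c at *
    generalize e' + 0 * a = e at *
    generalize f' + t * a = f at *
    have hf : 4 * f ^ 2 ≤ a ^ 2 := by nlinarith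
    by_cases hlt : b < a
    · have hb : 0 < b := by nlinarith [sq_nonneg f]
      exact (ih b a c e d f (by omega) hb (by linarith) (by rw [← hdet'']; ring)).of_swap
    · have h4 : 3 * a ^ 2 ≤ 4 * (a * b - f ^ 2) := by
        have := mul_le_mul_of_nonneg_left (not_lt.1 hlt) ha.le
        linarith [pow_two a]
      -- The bounds 3a² ≤ 4(ab - f²) and 3(ab - f²)² ≤ 4a give 27a⁴ ≤ 64a, so a < 2.
      have ha1 : a = 1 := by
        by_contra hne
        have h5 : 2 ≤ a := by omega
        have h6 : (3 * a ^ 2) ^ 2 ≤ (4 * (a * b - f ^ 2)) ^ 2 := by gcongr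
        have h7 : 27 * a ^ 4 ≤ 64 * a := by
          linarith [mul_pow 4 (a * b - f ^ 2) 2, (by ring : (3 * a ^ 2) ^ 2 = 9 * a ^ 4)]
        have h8 : 8 * a ≤ a ^ 4 := by
          have : 2 ^ 3 * a ≤ a ^ 3 * a := by gcongr
          linarith [pow_succ a 3]
        omega
      subst ha1
      exact isGram_of_first_eq_one (by linarith) (by rw [← hdet'']; ring)

/-! ### The three squares theorem -/

/-- If `-b` is a square modulo `b n - 1`, then `n` is a sum of three squares. -/
theorem sum_three_squares_of_dvd {n b a : ℤ} (hb : 0 < b) (hn : 1 < b * n)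
    (h : b * n - 1 ∣ a ^ 2 + b) : ∃ x y z : ℤ, n = x ^ 2 + y ^ 2 + z ^ 2 := by
  obtain ⟨k, hk⟩ := h
  have hk0 : 0 < k := by
    by_contra hneg
    nlinarith [mul_nonneg (by linarith : 0 ≤ b * n - 1) (by linarith : 0 ≤ -k), sq_nonneg a]
  -- With k(bn - 1) = a² + b, this matrix has determinant 1 and diagonal entry `n`.
  obtain ⟨_, _, _, _, _, _, x, y, z, -, -, h, -⟩ :=
    isGram_of_det_eq_one _ k (b * n - 1) n 0 1 a le_rfl hk0 (by linarith)
      (by linear_combination (-n) * hk)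
  exact ⟨x, y, z, h⟩

open NumberTheorySymbols in
theorem exists_dvd_sq_add_of_jacobiSym_eq_one {p b : ℕ} (hp : p.Prime) (h : J(-b | p) = 1) :
    ∃ a : ℤ, (p : ℤ) ∣ a ^ 2 + b := by
  have := Fact.mk hp
  obtain ⟨r, hr⟩ := ZMod.isSquare_of_jacobiSym_eq_one h
  obtain ⟨a, rfl⟩ := ZMod.intCast_surjective r
  refine ⟨a, (ZMod.intCast_zmod_eq_zero_iff_dvd _ p).1 ?_⟩
  push_cast at hr ⊢
  linear_combination -hr

open NumberTheorySymbols in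
theorem sum_three_squares_of_mod_four_eq_two {n : ℕ} (hn : n % 4 = 2) :
    ∃ x y z : ℤ, (n : ℤ) = x ^ 2 + y ^ 2 + z ^ 2 := by
  have hcop : (n - 1).Coprime (4 * n) := by
    refine Nat.Coprime.mul_right ?_ ?_
    · exact Nat.Coprime.pow_right 2 (Nat.coprime_two_right.2 (Nat.odd_iff.2 (by omega)))
    · exact (Nat.coprime_self_sub_left (by omega)).2 (Nat.coprime_one_left n)
  obtain ⟨p, hpn, hp, hmod⟩ := Nat.forall_exists_prime_gt_and_modEq n (by omega) hcop
  obtain ⟨j, hj⟩ := (Nat.modEq_iff_dvd' (by omega)).1 hmod.symm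
  have hpj : p + 1 = (4 * j + 1) * n := by
    have : p = 4 * n * j + (n - 1) := by omega
    rw [this, add_assoc, Nat.sub_add_cancel (by omega)]; ring
  have hp4 : p % 4 = 1 := by
    have hexp : (4 * j + 1) * n = 4 * (j * n) + n := by ring
    omega
  have hbodd : Odd (4 * j + 1) := ⟨2 * j, by ring⟩
  have hb4 : (4 * j + 1) % 4 = 1 := by omega
  -- Here p = bn - 1 with b = 4j + 1, so p ≡ -1 mod b and J(-b | p) = J(p | b) = J(-1 | b) = 1.
  have hJ : J(-(4 * j + 1 : ℕ) | p) = 1 := by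
    rw [jacobiSym.neg _ (Nat.odd_iff.2 (by omega)), ZMod.χ₄_nat_one_mod_four hp4, one_mul,
      jacobiSym.quadratic_reciprocity_one_mod_four hb4 (Nat.odd_iff.2 (by omega)),
      jacobiSym.mod_left' (a₂ := -1), jacobiSym.at_neg_one hbodd, ZMod.χ₄_nat_one_mod_four hb4]
    refine Int.ModEq.symm ((Int.modEq_iff_dvd).2 ⟨n, ?_⟩)
    linarith [show (p : ℤ) + 1 = ((4 * j + 1 : ℕ) : ℤ) * n from mod_cast hpj]
  obtain ⟨a, ha⟩ := exists_dvd_sq_add_of_jacobiSym_eq_one hp hJ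
  have hpj' : (p : ℤ) + 1 = ((4 * j + 1 : ℕ) : ℤ) * n := mod_cast hpj
  have hp2 := hp.two_le
  refine sum_three_squares_of_dvd (b := ((4 * j + 1 : ℕ) : ℤ)) (a := a) (by positivity) ?_ ?_
  · rw [← hpj']; omega
  · rw [← hpj', add_sub_cancel_right]; exact ha

open NumberTheorySymbols in
/-- The odd case of the three squares theorem, reduced to Dirichlet's theorem: `c` is the residue
modulo `8` of the multiplier `b` with `b n - 1 = 2 p`. -/
theorem sum_three_squares_of_odd {n c m : ℕ} (hc : c = 1 ∨ c = 3) (hm : 2 * m + 1 = c * n)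
    (hodd : m % 2 = 1) (hn : n % 2 = 1) (hcm : c = 1 → m % 4 = 1) :
    ∃ x y z : ℤ, (n : ℤ) = x ^ 2 + y ^ 2 + z ^ 2 := by
  have hcop : m.Coprime (4 * n) := by
    refine Nat.Coprime.mul_right ?_ ?_
    · exact Nat.Coprime.pow_right 2 (Nat.coprime_two_right.2 (Nat.odd_iff.2 hodd))
    · refine Nat.Coprime.coprime_mul_left_right (k := c) ?_
      rw [← hm]
      simp
  obtain ⟨p, hpn, hp, hmod⟩ := Nat.forall_exists_prime_gt_and_modEq m (by omega) hcop
  obtain ⟨j, hj⟩ := (Nat.modEq_iff_dvd' hpn.le).1 hmod.symm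
  have hpm : p = 4 * n * j + m := by omega
  have hpj : 2 * p + 1 = (8 * j + c) * n := by
    rw [hpm, add_mul, ← hm]; ring
  have hp4 : p % 4 = m % 4 := by rw [hpm, mul_assoc]; omega
  have hbodd : Odd (8 * j + c) := Nat.odd_iff.2 (by omega)
  have hpodd : Odd p := Nat.odd_iff.2 (by omega)
  have hpj' : 2 * (p : ℤ) + 1 = ((8 * j + c : ℕ) : ℤ) * n := mod_cast hpj
  have hpb : J(p | 8 * j + c) = 1 := by
    have h1 : J(-2 * p | 8 * j + c) = 1 := by
      rw [jacobiSym.mod_left' (a₂ := 1), jacobiSym.one_left]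
      exact (Int.modEq_iff_dvd).2 ⟨n, by linarith⟩
    rw [jacobiSym.mul_left, jacobiSym.at_neg_two hbodd, ZMod.χ₈'_nat_eq_if_mod_eight] at h1
    rw [if_neg (by omega), if_pos (by omega), one_mul] at h1
    exact h1
  have hJ : J(-(8 * j + c : ℕ) | p) = 1 := by
    rw [jacobiSym.neg _ hpodd]
    rcases (by omega : p % 4 = 1 ∨ p % 4 = 3) with h | h
    · rw [ZMod.χ₄_nat_one_mod_four h, one_mul,
        jacobiSym.quadratic_reciprocity_one_mod_four' hbodd h, hpb]
    · rw [ZMod.χ₄_nat_three_mod_four h,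
        jacobiSym.quadratic_reciprocity_three_mod_four (by omega) h, hpb]
      norm_num
  obtain ⟨a, ha⟩ := exists_dvd_sq_add_of_jacobiSym_eq_one hp hJ
  -- The modulus is 2p and b is odd, so the root must be odd; adding p corrects its parity.
  obtain ⟨a', ha', hpar⟩ : ∃ a' : ℤ, (p : ℤ) ∣ a' ^ 2 + ((8 * j + c : ℕ) : ℤ) ∧ a' % 2 = 1 := by
    rcases Int.emod_two_eq_zero_or_one a with h | h
    · refine ⟨a + p, ?_, by obtain ⟨k, hk⟩ := hpodd; omega⟩
      have : (a + p) ^ 2 + ((8 * j + c : ℕ) : ℤ) =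
        (a ^ 2 + ((8 * j + c : ℕ) : ℤ)) + p * (2 * a + p) := by ring
      rw [this]
      exact dvd_add ha (dvd_mul_right _ _)
    · exact ⟨a, ha, h⟩
  have hp2 := hp.two_le
  refine sum_three_squares_of_dvd (b := ((8 * j + c : ℕ) : ℤ)) (a := a') (by omega) ?_ ?_
  · rw [← hpj']; omega
  · rw [← hpj', add_sub_cancel_right]
    refine IsCoprime.mul_dvd ?_ ?_ ha'
    · exact Nat.isCoprime_iff_coprime.2 (Nat.coprime_two_left.2 hpodd)
    · rw [Int.dvd_iff_emod_eq_zero, Int.add_emod, pow_two, Int.mul_emod, hpar]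
      have : ((8 * j + c : ℕ) : ℤ) % 2 = 1 := by omega
      rw [this]; norm_num

/-- **Legendre's three squares theorem.** -/
theorem sum_three_squares (N : ℕ) : (∀ k l : ℕ, N ≠ 4 ^ k * (8 * l + 7)) →
    ∃ x y z : ℤ, (N : ℤ) = x ^ 2 + y ^ 2 + z ^ 2 := by
  induction N using Nat.strong_induction_on with
  | _ N ih =>
    intro h
    rcases Nat.eq_zero_or_pos N with rfl | hN
    · exact ⟨0, 0, 0, by norm_num⟩
    by_cases h4 : N % 4 = 0
    · obtain ⟨M, rfl⟩ := Nat.dvd_of_mod_eq_zero h4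
      obtain ⟨x, y, z, hxyz⟩ := ih M (by omega) fun k l hkl =>
        h (k + 1) l (by rw [hkl, pow_succ]; ring)
      refine ⟨2 * x, 2 * y, 2 * z, ?_⟩
      push_cast
      rw [hxyz]; ring
    have h7 : N % 8 ≠ 7 := fun h7 => h 0 (N / 8) (by omega)
    rcases (by omega : N % 4 = 2 ∨ N % 8 = 3 ∨ N % 4 = 1) with h2 | h3 | h1
    · exact sum_three_squares_of_mod_four_eq_two h2
    · exact sum_three_squares_of_odd (c := 1) (m := (N - 1) / 2) (Or.inl rfl) (by omega) (by omega)
        (by omega) (by omega)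
    · exact sum_three_squares_of_odd (c := 3) (m := (3 * N - 1) / 2) (Or.inr rfl) (by omega)
        (by omega) (by omega) (by omega)

/-! ### Representation by s² + 5(y² + z²) -/

theorem four_pow_succ_mul (k m : ℕ) : 4 ^ (k + 1) * m = 4 * (4 ^ k * m) := by
  ring

theorem exists_five_mul_sum_two_squares {b c : ℤ} (h : (b ^ 2 + c ^ 2) % 5 = 0) :
    ∃ y z : ℤ, b ^ 2 + c ^ 2 = 5 * (y ^ 2 + z ^ 2) := by
  have hcases : (c - 2 * b) % 5 = 0 ∨ (c + 2 * b) % 5 = 0 := by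
    have hb : b % 5 = 0 ∨ b % 5 = 1 ∨ b % 5 = 2 ∨ b % 5 = 3 ∨ b % 5 = 4 := by omega
    have hc : c % 5 = 0 ∨ c % 5 = 1 ∨ c % 5 = 2 ∨ c % 5 = 3 ∨ c % 5 = 4 := by omega
    rcases hb with hb | hb | hb | hb | hb <;> rcases hc with hc | hc | hc | hc | hc <;>
      first
      | omega
      | simp [pow_two, Int.add_emod, Int.mul_emod, hb, hc] at h
  rcases hcases with h | h
  · obtain ⟨t, ht⟩ := Int.dvd_of_emod_eq_zero h
    obtain rfl : c = 2 * b + 5 * t := by linarith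
    exact ⟨b + 2 * t, t, by ring⟩
  · obtain ⟨t, ht⟩ := Int.dvd_of_emod_eq_zero h
    obtain rfl : c = -2 * b + 5 * t := by linarith
    exact ⟨b - 2 * t, t, by ring⟩

theorem sq_emod_five (a : ℤ) : a ^ 2 % 5 = 0 ∧ a % 5 = 0 ∨ a ^ 2 % 5 = 1 ∨ a ^ 2 % 5 = 4 := by
  have ha : a % 5 = 0 ∨ a % 5 = 1 ∨ a % 5 = 2 ∨ a % 5 = 3 ∨ a % 5 = 4 := by omega
  rcases ha with ha | ha | ha | ha | ha <;> simp [pow_two, Int.mul_emod, ha]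

theorem sq_emod_four (a : ℤ) : a ^ 2 % 4 = 0 ∧ a % 2 = 0 ∨ a ^ 2 % 4 = 1 ∧ a % 2 = 1 := by
  rcases Int.emod_two_eq_zero_or_one a with h | h
  · obtain ⟨t, rfl⟩ := Int.dvd_of_emod_eq_zero h
    left
    have : (2 * t) ^ 2 = 4 * t ^ 2 := by ring
    omega
  · obtain ⟨t, rfl⟩ : ∃ t, a = 2 * t + 1 := ⟨a / 2, by omega⟩
    right
    have : (2 * t + 1) ^ 2 = 4 * (t ^ 2 + t) + 1 := by ring
    omega

/-- The integers represented by `s² + 5 y² + 5 z²`. -/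
theorem exists_eq_sq_add_five_mul {N : ℕ} (h5 : N % 5 = 0 ∨ N % 5 = 1 ∨ N % 5 = 4)
    (h : ∀ k l : ℕ, N ≠ 4 ^ k * (8 * l + 7)) :
    ∃ s y z : ℤ, (N : ℤ) = s ^ 2 + 5 * (y ^ 2 + z ^ 2) := by
  obtain ⟨a, b, c, habc⟩ := sum_three_squares N h
  have key : (b ^ 2 + c ^ 2) % 5 = 0 ∨ (a ^ 2 + c ^ 2) % 5 = 0 ∨ (a ^ 2 + b ^ 2) % 5 = 0 := by
    have ha := sq_emod_five a
    have hb := sq_emod_five b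
    have hc := sq_emod_five c
    generalize a ^ 2 = A at *
    generalize b ^ 2 = B at *
    generalize c ^ 2 = C at *
    omega
  rcases key with h | h | h
  · obtain ⟨y, z, hyz⟩ := exists_five_mul_sum_two_squares h
    exact ⟨a, y, z, by linarith⟩
  · obtain ⟨y, z, hyz⟩ := exists_five_mul_sum_two_squares h
    exact ⟨b, y, z, by linarith⟩
  · obtain ⟨y, z, hyz⟩ := exists_five_mul_sum_two_squares h
    exact ⟨c, y, z, by linarith⟩

/-- A nonzero sum of two squares has a representation by two integers not both divisible
by `5`. -/
theorem exists_sum_two_squares_not_dvd_five (k : ℕ) : ∀ u v : ℤ, u.natAbs + v.natAbs ≤ k →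
    u ≠ 0 ∨ v ≠ 0 → ∃ x y : ℤ, u ^ 2 + v ^ 2 = x ^ 2 + y ^ 2 ∧ ¬ (x % 5 = 0 ∧ y % 5 = 0) := by
  induction k with
  | zero => intro u v h h0; omega
  | succ k ih =>
    intro u v hk h0
    by_cases hdvd : u % 5 = 0 ∧ v % 5 = 0
    · obtain ⟨u, rfl⟩ := Int.dvd_of_emod_eq_zero hdvd.1
      obtain ⟨v, rfl⟩ := Int.dvd_of_emod_eq_zero hdvd.2
      obtain ⟨x, y, hxy, hn⟩ := ih u v (by omega) (by omega)
      -- Multiplying x + iy by (3 ± 4i), of norm 25; the two signs cannot both give a multiple of 5.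
      by_cases hc : (3 * x - 4 * y) % 5 = 0
      · exact ⟨3 * x + 4 * y, 4 * x - 3 * y, by linear_combination 25 * hxy, by omega⟩
      · exact ⟨3 * x - 4 * y, 4 * x + 3 * y, by linear_combination 25 * hxy, by omega⟩
    · exact ⟨u, v, rfl, hdvd⟩

/-- A sum of three squares `N ≡ 9 (mod 20)` whose two even terms are not both divisible by `5`
can be written as `s² + 5 (y² + z²)` with `s` even. -/
theorem exists_even_of_not_dvd_five {N a b c : ℤ} (hN : N % 20 = 9)
    (habc : N = a ^ 2 + b ^ 2 + c ^ 2) (ha : a % 2 = 1) (hbc : ¬ (b % 5 = 0 ∧ c % 5 = 0)) :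
    ∃ s y z : ℤ, N = s ^ 2 + 5 * (y ^ 2 + z ^ 2) ∧ s % 2 = 0 := by
  -- The squares are {0, 0, -1} or {1, -1, -1} mod 5, so the odd one pairs with an even one.
  have key : (a ^ 2 + c ^ 2) % 5 = 0 ∧ b % 2 = 0 ∨ (a ^ 2 + b ^ 2) % 5 = 0 ∧ c % 2 = 0 := by
    have ha5 := sq_emod_five a
    have hb5 := sq_emod_five b
    have hc5 := sq_emod_five c
    have ha4 := sq_emod_four a
    have hb4 := sq_emod_four b
    have hc4 := sq_emod_four c
    generalize a ^ 2 = A at *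
    generalize b ^ 2 = B at *
    generalize c ^ 2 = C at *
    omega
  rcases key with ⟨h, h2⟩ | ⟨h, h2⟩
  · obtain ⟨y, z, hyz⟩ := exists_five_mul_sum_two_squares h
    exact ⟨b, y, z, by linarith, h2⟩
  · obtain ⟨y, z, hyz⟩ := exists_five_mul_sum_two_squares h
    exact ⟨c, y, z, by linarith, h2⟩

theorem exists_even_or_eq_sq {N : ℕ} (hN : N % 20 = 9) :
    (∃ s y z : ℤ, (N : ℤ) = s ^ 2 + 5 * (y ^ 2 + z ^ 2) ∧ s % 2 = 0) ∨
      ∃ s : ℤ, (N : ℤ) = s ^ 2 := by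
  have hex : ∀ k l : ℕ, N ≠ 4 ^ k * (8 * l + 7) := by
    rintro (_ | k) l h
    · omega
    · rw [four_pow_succ_mul] at h; omega
  have hodd : ∀ a b c : ℤ, (N : ℤ) = a ^ 2 + b ^ 2 + c ^ 2 → a % 2 = 1 →
      (∃ s y z : ℤ, (N : ℤ) = s ^ 2 + 5 * (y ^ 2 + z ^ 2) ∧ s % 2 = 0) ∨
      ∃ s : ℤ, (N : ℤ) = s ^ 2 := by
    intro a b c habc ha
    by_cases h0 : b ≠ 0 ∨ c ≠ 0
    · obtain ⟨x, y, hxy, hn⟩ := exists_sum_two_squares_not_dvd_five _ b c le_rfl h0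
      exact Or.inl (exists_even_of_not_dvd_five (by omega) (by linarith) ha hn)
    · obtain ⟨rfl, rfl⟩ : b = 0 ∧ c = 0 := by omega
      exact Or.inr ⟨a, by linarith⟩
  obtain ⟨a, b, c, habc⟩ := sum_three_squares N hex
  have key : a % 2 = 1 ∨ b % 2 = 1 ∨ c % 2 = 1 := by
    have ha4 := sq_emod_four a
    have hb4 := sq_emod_four b
    have hc4 := sq_emod_four c
    generalize a ^ 2 = A at *
    generalize b ^ 2 = B at *
    generalize c ^ 2 = C at *
    omega
  rcases key with h | h | h
  · exact hodd a b c habc h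
  · exact hodd b a c (by linarith) h
  · exact hodd c a b (by linarith) h

/-! ### The form 2x - y: (i) and (ii) -/

/-- `n` is a sum of four squares of natural numbers `x, y, z, w` with `|2 x - y| = m`. -/
def HasRep (n : ℕ) (m : ℤ) : Prop :=
  ∃ x y z w : ℕ, n = x ^ 2 + y ^ 2 + z ^ 2 + w ^ 2 ∧ |2 * (x : ℤ) - (y : ℤ)| = m

theorem HasRep.scale {n : ℕ} {m : ℤ} (h : HasRep n m) (c : ℕ) : HasRep (c ^ 2 * n) (c * m) := by
  obtain ⟨x, y, z, w, rfl, h⟩ := h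
  refine ⟨c * x, c * y, c * z, c * w, by ring, ?_⟩
  push_cast
  rw [← h, ← Nat.abs_cast c, ← abs_mul, Nat.abs_cast]
  congr 1; ring

theorem exists_two_mul_sub_eq {n m s z w : ℤ} (h : 5 * n = m ^ 2 + s ^ 2 + 5 * (z ^ 2 + w ^ 2)) :
    ∃ x y : ℤ, n = x ^ 2 + y ^ 2 + z ^ 2 + w ^ 2 ∧ 2 * x - y = m ∧
      (x + 2 * y = s ∨ x + 2 * y = -s) := by
  have hms : (s + 2 * m) % 5 = 0 ∨ (s - 2 * m) % 5 = 0 := by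
    have h0 : (m ^ 2 + s ^ 2) % 5 = 0 := by omega
    have hb : m % 5 = 0 ∨ m % 5 = 1 ∨ m % 5 = 2 ∨ m % 5 = 3 ∨ m % 5 = 4 := by omega
    have hc : s % 5 = 0 ∨ s % 5 = 1 ∨ s % 5 = 2 ∨ s % 5 = 3 ∨ s % 5 = 4 := by omega
    rcases hb with hb | hb | hb | hb | hb <;> rcases hc with hc | hc | hc | hc | hc <;>
      first
      | omega
      | simp [pow_two, Int.add_emod, Int.mul_emod, hb, hc] at h0
  rcases hms with h' | h'
  · obtain ⟨t, ht⟩ := Int.dvd_of_emod_eq_zero h'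
    obtain rfl : s = 5 * t - 2 * m := by linarith
    exact ⟨t, 2 * t - m, by linarith, by ring, Or.inl (by ring)⟩
  · obtain ⟨t, ht⟩ := Int.dvd_of_emod_eq_zero h'
    obtain rfl : s = 5 * t + 2 * m := by linarith
    exact ⟨-t, -2 * t - m, by linarith, by ring, Or.inr (by ring)⟩

theorem hasRep_of_mul_nonneg {n : ℕ} {x y z w : ℤ} (h : (n : ℤ) = x ^ 2 + y ^ 2 + z ^ 2 + w ^ 2)
    (hxy : 0 ≤ x * y) : HasRep n |2 * x - y| := by
  refine ⟨x.natAbs, y.natAbs, z.natAbs, w.natAbs, ?_, ?_⟩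
  · zify; simpa only [sq_abs] using h
  · push_cast
    rcases mul_nonneg_iff.1 hxy with ⟨hx, hy⟩ | ⟨hx, hy⟩
    · rw [abs_of_nonneg hx, abs_of_nonneg hy]
    · rw [abs_of_nonpos hx, abs_of_nonpos hy, ← abs_neg]
      congr 1; ring

/-- If x, y have opposite signs then |2x - y| ≥ 3, and 2x - y = 4 only at (1, -2), where x + 2y =
-3. -/
theorem hasRep_of_small {n : ℕ} {m s z w : ℤ} (hm : 0 ≤ m ∧ m ≤ 2 ∨ m = 4 ∧ s ≠ 3 ∧ s ≠ -3)
    (h : 5 * (n : ℤ) = m ^ 2 + s ^ 2 + 5 * (z ^ 2 + w ^ 2)) : HasRep n m := by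
  obtain ⟨x, y, hn, hxm, hs⟩ := exists_two_mul_sub_eq h
  have hxy : 0 ≤ x * y := by
    by_contra hneg
    rcases mul_neg_iff.1 (not_le.1 hneg) with ⟨h1, h2⟩ | ⟨h1, h2⟩ <;> omega
  have := hasRep_of_mul_nonneg hn hxy
  rwa [hxm, abs_of_nonneg (by omega)] at this

/-- The case `m ≤ 2`, where no sign condition is needed. -/
theorem hasRep_of_forall_ne {n m : ℕ} (hm : m ≤ 2) (hle : m ^ 2 ≤ 5 * n)
    (h : ∀ k l : ℕ, 5 * n - m ^ 2 ≠ 4 ^ k * (8 * l + 7)) : HasRep n m := by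
  have h5 : (5 * n - m ^ 2) % 5 = 0 ∨ (5 * n - m ^ 2) % 5 = 1 ∨ (5 * n - m ^ 2) % 5 = 4 := by
    interval_cases m <;> omega
  obtain ⟨s, y, z, hs⟩ := exists_eq_sq_add_five_mul h5 h
  refine hasRep_of_small (s := s) (z := y) (w := z) (Or.inl ⟨by positivity, mod_cast hm⟩) ?_
  rw [Nat.cast_sub hle] at hs
  push_cast at hs
  linarith

theorem ne_four_pow_mul_of_mod {N : ℕ} (h : N % 4 = 1 ∨ N % 4 = 2 ∨ N % 8 = 3) (k l : ℕ) :
    N ≠ 4 ^ k * (8 * l + 7) := by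
  rcases k with _ | k
  · omega
  · intro h; rw [four_pow_succ_mul] at h; omega

/-- Since 5n - 16 ≡ 9 mod 20, s can be taken even, hence not ±3, unless 5n - 16 = s²; there s = ±3
means n = 5. -/
theorem hasRep_four {n : ℕ} (h5 : n ≠ 5) (hN : (5 * n - 16) % 4 = 1) (h16 : 16 ≤ 5 * n) :
    HasRep n 4 := by
  have key : ∃ s y z : ℤ, ((5 * n - 16 : ℕ) : ℤ) = s ^ 2 + 5 * (y ^ 2 + z ^ 2) ∧
      s ≠ 3 ∧ s ≠ -3 := by
    rcases exists_even_or_eq_sq (N := 5 * n - 16) (by omega) with ⟨s, y, z, h, hs⟩ | ⟨s, h⟩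
    · exact ⟨s, y, z, h, by omega, by omega⟩
    · refine ⟨s, 0, 0, by linarith, ?_, ?_⟩ <;> rintro rfl <;> omega
  obtain ⟨s, y, z, h, hs⟩ := key
  refine hasRep_of_small (s := s) (z := y) (w := z) (Or.inr ⟨rfl, hs⟩) ?_
  rw [Nat.cast_sub h16] at h
  push_cast at h
  linarith

theorem hasRep_four_of_eight {n : ℕ} (hn : n % 16 = 8) : HasRep n 4 := by
  obtain ⟨s, y, z, h⟩ := exists_eq_sq_add_five_mul (N := 5 * n - 16) (by omega) (by
    rintro (_ | _ | k) l
    · omega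
    · omega
    · intro h; rw [four_pow_succ_mul, four_pow_succ_mul] at h; omega)
  have hs : s % 2 = 0 := by
    have h1 := sq_emod_four s
    have h2 := sq_emod_four y
    have h3 := sq_emod_four z
    generalize s ^ 2 = A at *
    generalize y ^ 2 = B at *
    generalize z ^ 2 = C at *
    omega
  refine hasRep_of_small (s := s) (z := y) (w := z) (Or.inr ⟨rfl, by omega, by omega⟩) ?_
  rw [Nat.cast_sub (by omega)] at h
  push_cast at h
  linarith

theorem exists_hasRep_four_pow (n : ℕ) : 1 ≤ n → ∃ k : ℕ, HasRep n (4 ^ k) := by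
  induction n using Nat.strong_induction_on with
  | _ n ih =>
    intro hn
    by_cases h16 : n % 16 = 0
    · obtain ⟨r, rfl⟩ := Nat.dvd_of_mod_eq_zero h16
      obtain ⟨k, hk⟩ := ih r (by omega) (by omega)
      exact ⟨k + 1, by simpa [pow_succ, mul_comm] using hk.scale 4⟩
    by_cases hex : ∀ k l : ℕ, 5 * n - 1 ^ 2 ≠ 4 ^ k * (8 * l + 7)
    · exact ⟨0, by simpa using hasRep_of_forall_ne (m := 1) (by norm_num) (by omega) hex⟩
    · push Not at hex
      obtain ⟨k, l, h⟩ := hex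
      refine ⟨1, ?_⟩
      rw [pow_one]
      -- `k = 0` forces n ≡ 8 mod 16; otherwise n ≡ 1 mod 4.
      rcases k with _ | k
      · exact hasRep_four_of_eight (by omega)
      · rw [four_pow_succ_mul] at h
        have hn4 : n ≠ 5 ∧ (5 * n - 16) % 4 = 1 ∧ 16 ≤ 5 * n := by
          rcases k with _ | k
          · omega
          · rw [four_pow_succ_mul] at h
            omega
        exact hasRep_four hn4.1 hn4.2.1 hn4.2.2

theorem hasRep_zero {n : ℕ} (h : ∀ k l : ℕ, n ≠ 4 ^ k * (8 * l + 3)) : HasRep n 0 := by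
  refine mod_cast hasRep_of_forall_ne (m := 0) (by norm_num) (by omega) fun k => ?_
  suffices ∀ N l : ℕ, 5 * N = 4 ^ k * (8 * l + 7) → ∃ l', N = 4 ^ k * (8 * l' + 3) by
    intro l hl
    obtain ⟨l', hl'⟩ := this n l (by simpa using hl)
    exact h k l' hl'
  induction k with
  | zero => intro N l hN; exact ⟨N / 8, by omega⟩
  | succ k ih =>
    intro N l hN
    rw [four_pow_succ_mul] at hN
    obtain ⟨M, rfl⟩ : 4 ∣ N := by omega
    obtain ⟨l', hl'⟩ := ih M l (by omega)
    exact ⟨l', by rw [hl', pow_succ]; ring⟩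

theorem exists_hasRep_eight_pow {a : ℕ} (ha : a = 1 ∨ a = 2) (n : ℕ) :
    HasRep n 0 ∨ ∃ k : ℕ, HasRep n (a * 8 ^ k) := by
  by_cases hex : ∀ k l : ℕ, n ≠ 4 ^ k * (8 * l + 3)
  · exact Or.inl (hasRep_zero hex)
  push Not at hex
  obtain ⟨k, l, rfl⟩ := hex
  right
  induction k using Nat.strong_induction_on with
  | _ k ih =>
    have h1 : HasRep (8 * l + 3) 1 := mod_cast hasRep_of_forall_ne (m := 1) (by norm_num)
      (by omega) (ne_four_pow_mul_of_mod (by omega))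
    have h2 : HasRep (8 * l + 3) 2 := mod_cast hasRep_of_forall_ne (m := 2) (by norm_num)
      (by omega) (ne_four_pow_mul_of_mod (by omega))
    have h3 : HasRep (4 * (8 * l + 3)) 1 := mod_cast hasRep_of_forall_ne (m := 1) (by norm_num)
      (by omega) (ne_four_pow_mul_of_mod (by omega))
    -- Scaling by 8 multiplies n by 4³ and m by 8, so only k mod 3 matters.
    rcases k with _ | _ | _ | k
    · refine ⟨0, ?_⟩
      rcases ha with rfl | rfl
      · simpa using h1
      · simpa using h2
    · refine ⟨0, ?_⟩
      rcases ha with rfl | rfl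
      · simpa using h3
      · simpa using h1.scale 2
    · rcases ha with rfl | rfl
      · exact ⟨1, by simpa using h2.scale 4⟩
      · refine ⟨0, ?_⟩
        have := h3.scale 2
        rw [← mul_assoc] at this
        simpa using this
    · obtain ⟨j, hj⟩ := ih k (by omega)
      refine ⟨j + 1, ?_⟩
      have := hj.scale 8
      rw [show 8 ^ 2 * (4 ^ k * (8 * l + 3)) = 4 ^ (k + 1 + 1 + 1) * (8 * l + 3) by ring,
        show ((8 : ℕ) : ℤ) * (a * 8 ^ j) = a * 8 ^ (j + 1) by push_cast; ring] at this
      exact this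

/-! ### The form x + 3y: (iii) -/

/-- `n` is a sum of four integer squares `x² + y² + z² + w²` with `x + 3 y = m`. -/
def HasAddRep (n m : ℤ) : Prop :=
  ∃ x y z w : ℤ, n = x ^ 2 + y ^ 2 + z ^ 2 + w ^ 2 ∧ x + 3 * y = m

theorem hasAddRep_of_even {n m s u v : ℤ} (h : 10 * n = m ^ 2 + s ^ 2 + 5 * (u ^ 2 + v ^ 2))
    (huv : (u + v) % 2 = 0) : HasAddRep n m := by
  obtain ⟨z, rfl⟩ : ∃ z, u = 2 * z - v := ⟨(u + v) / 2, by omega⟩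
  have h10 : 10 * n = m ^ 2 + s ^ 2 + 10 * (z ^ 2 + (z - v) ^ 2) := by linarith
  have h2 : (s + 3 * m) % 2 = 0 := by
    have h1 := sq_emod_four m
    have h2 := sq_emod_four s
    generalize z ^ 2 + (z - v) ^ 2 = Z at *
    omega
  have hms : (s + 3 * m) % 5 = 0 ∨ (s - 3 * m) % 5 = 0 := by
    have h0 : (m ^ 2 + s ^ 2) % 5 = 0 := by omega
    have hb : m % 5 = 0 ∨ m % 5 = 1 ∨ m % 5 = 2 ∨ m % 5 = 3 ∨ m % 5 = 4 := by omega
    have hc : s % 5 = 0 ∨ s % 5 = 1 ∨ s % 5 = 2 ∨ s % 5 = 3 ∨ s % 5 = 4 := by omega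
    rcases hb with hb | hb | hb | hb | hb <;> rcases hc with hc | hc | hc | hc | hc <;>
      first
      | omega
      | simp [pow_two, Int.add_emod, Int.mul_emod, hb, hc] at h0
  rcases hms with h' | h'
  · obtain ⟨t, rfl⟩ : ∃ t, s = 10 * t - 3 * m := ⟨(s + 3 * m) / 10, by omega⟩
    exact ⟨m - 3 * t, t, z, z - v, by linarith, by ring⟩
  · obtain ⟨t, rfl⟩ : ∃ t, s = 10 * t + 3 * m := ⟨(s - 3 * m) / 10, by omega⟩
    exact ⟨m + 3 * t, -t, z, z - v, by linarith, by ring⟩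

theorem HasAddRep.scale {n m : ℤ} (h : HasAddRep n m) (c : ℤ) : HasAddRep (c ^ 2 * n) (c * m) := by
  obtain ⟨x, y, z, w, rfl, rfl⟩ := h
  exact ⟨c * x, c * y, c * z, c * w, by ring, by ring⟩

/-- A representation of `N` by `s² + 5 u² + 5 v²` doubles to one with `u ≡ v (mod 2)`. -/
theorem hasAddRep_of_four_mul {n m : ℤ} {N : ℕ} (c : ℤ) (hc : c % 2 = 0)
    (hN : 10 * n = m ^ 2 + c ^ 2 * N) (h5 : N % 5 = 0 ∨ N % 5 = 1 ∨ N % 5 = 4)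
    (h : ∀ k l : ℕ, N ≠ 4 ^ k * (8 * l + 7)) : HasAddRep n m := by
  obtain ⟨s, y, z, hs⟩ := exists_eq_sq_add_five_mul h5 h
  obtain ⟨d, rfl⟩ := Int.dvd_of_emod_eq_zero hc
  refine hasAddRep_of_even (s := 2 * d * s) (u := 2 * d * y) (v := 2 * d * z) ?_ ?_
  · rw [hN, hs]; ring
  · rw [mul_assoc, mul_assoc, ← mul_add, Int.mul_emod_right]

theorem exists_hasAddRep_four_pow
    (H : ∀ m : ℕ, 1 ≤ m → m ≡ 9 [MOD 20] →
      ∃ x y z : ℤ, (m : ℤ) = 5 * x ^ 2 + 5 * y ^ 2 + z ^ 2 ∧ ¬ (2 ∣ z)) (n : ℕ) :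
    1 ≤ n → ∃ k : ℕ, HasAddRep n (4 ^ k) := by
  induction n using Nat.strong_induction_on with
  | _ n ih =>
    intro hn
    rcases (by omega : n % 2 = 1 ∨ n % 4 = 2 ∨ n % 8 = 4 ∨ n % 16 = 8 ∨ n % 16 = 0) with
      h | h | h | h | h
    · obtain ⟨x, y, z, hxyz, hz⟩ := H (10 * n - 1) (by omega)
        (by show (10 * n - 1) % 20 = 9 % 20; omega)
      rw [Nat.cast_sub (by omega)] at hxyz
      push_cast at hxyz
      refine ⟨0, hasAddRep_of_even (s := z) (u := x) (v := y) (by linarith) ?_⟩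
      have h1 := sq_emod_four x
      have h2 := sq_emod_four y
      have h3 := sq_emod_four z
      generalize x ^ 2 = A at *
      generalize y ^ 2 = B at *
      generalize z ^ 2 = C at *
      omega
    · obtain ⟨s, y, z, hs⟩ := exists_eq_sq_add_five_mul (N := 10 * n - 1) (by omega)
        (ne_four_pow_mul_of_mod (by omega))
      rw [Nat.cast_sub (by omega)] at hs
      push_cast at hs
      refine ⟨0, hasAddRep_of_even (s := s) (u := y) (v := z) (by linarith) ?_⟩
      have h1 := sq_emod_four s
      have h2 := sq_emod_four y
      have h3 := sq_emod_four z
      generalize s ^ 2 = A at *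
      generalize y ^ 2 = B at *
      generalize z ^ 2 = C at *
      omega
    · obtain ⟨r, rfl⟩ : 4 ∣ n := by omega
      exact ⟨1, hasAddRep_of_four_mul (N := 10 * r - 4) 2 (by norm_num)
        (by rw [Nat.cast_sub (by omega)]; push_cast; ring) (by omega)
        (ne_four_pow_mul_of_mod (by omega))⟩
    · obtain ⟨j, rfl⟩ : ∃ j, n = 16 * j + 8 := ⟨n / 16, by omega⟩
      -- 10n = 4² + 16(10j + 4) = 16² + 16(10j - 11); if 10j + 4 is excluded then j is even and 10j
      -- - 11 ≡ 1 mod 4.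
      by_cases hex : ∀ k l : ℕ, 10 * j + 4 ≠ 4 ^ k * (8 * l + 7)
      · exact ⟨1, hasAddRep_of_four_mul (N := 10 * j + 4) 4 (by norm_num)
          (by push_cast; ring) (by omega) hex⟩
      · push Not at hex
        obtain ⟨k, l, hkl⟩ := hex
        rcases k with _ | k
        · omega
        rw [four_pow_succ_mul] at hkl
        have hj : j ≠ 0 := by
          rintro rfl
          rcases k with _ | k
          · omega
          · rw [four_pow_succ_mul] at hkl; omega
        exact ⟨2, hasAddRep_of_four_mul (N := 10 * j - 11) 4 (by norm_num)
          (by rw [Nat.cast_sub (by omega)]; push_cast; ring) (by omega)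
          (ne_four_pow_mul_of_mod (by omega))⟩
    · obtain ⟨r, rfl⟩ := Nat.dvd_of_mod_eq_zero h
      obtain ⟨k, hk⟩ := ih r (by omega) (by omega)
      refine ⟨k + 1, ?_⟩
      have := hk.scale 4
      rw [pow_succ']
      exact mod_cast this

theorem theorem1p2 :
    -- (i)
    (∀ n : ℕ, 1 ≤ n → ∃ x y z w : ℕ, n = x ^ 2 + y ^ 2 + z ^ 2 + w ^ 2 ∧
      |2 * (x : ℤ) - (y : ℤ)| ∈ {m : ℤ | ∃ k : ℕ, m = 4 ^ k}) ∧
    -- (ii)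
    (∀ a : ℤ, a = 1 ∨ a = 2 →
      (∀ n : ℕ, ∃ x y z w : ℕ, n = x ^ 2 + y ^ 2 + z ^ 2 + w ^ 2 ∧
        2 * (x : ℤ) - (y : ℤ) ∈
          {m : ℤ | ∃ k : ℕ, m = a * 8 ^ k ∨ m = -(a * 8 ^ k)} ∪ {0}) ∧
      {m : ℤ | ∃ k : ℕ, m = a * 8 ^ k ∨ m = -(a * 8 ^ k)} ∪ {0} ⊆
        {m : ℤ | ∃ t : ℤ, m = a * t ^ 3}) ∧
    -- (iii)
    ((∀ m : ℕ, 1 ≤ m → m ≡ 9 [MOD 20] →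
        ∃ x y z : ℤ, (m : ℤ) = 5 * x ^ 2 + 5 * y ^ 2 + z ^ 2 ∧ ¬ (2 ∣ z)) →
      ∀ n : ℕ, 1 ≤ n → ∃ x y z w : ℤ, (n : ℤ) = x ^ 2 + y ^ 2 + z ^ 2 + w ^ 2 ∧
        x + 3 * y ∈ {m : ℤ | ∃ k : ℕ, m = 4 ^ k}) := by
  refine ⟨fun n hn => ?_, fun a ha => ⟨fun n => ?_, ?_⟩, fun H n hn => ?_⟩
  · obtain ⟨k, x, y, z, w, h, hk⟩ := exists_hasRep_four_pow n hn
    exact ⟨x, y, z, w, h, k, hk⟩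
  · obtain ⟨b, hb, rfl⟩ : ∃ b : ℕ, (b = 1 ∨ b = 2) ∧ a = b := ⟨a.toNat, by omega, by omega⟩
    rcases exists_hasRep_eight_pow hb n with ⟨x, y, z, w, h, hk⟩ | ⟨k, x, y, z, w, h, hk⟩
    · exact ⟨x, y, z, w, h, Or.inr (abs_eq_zero.1 hk)⟩
    · exact ⟨x, y, z, w, h, Or.inl ⟨k, (abs_eq (by positivity)).1 hk⟩⟩
  · have h8 : ∀ k : ℕ, (8 : ℤ) ^ k = (2 ^ k) ^ 3 := fun k => by
      rw [← pow_mul, mul_comm, pow_mul]; norm_num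
    rintro m (⟨k, rfl | rfl⟩ | rfl)
    · exact ⟨2 ^ k, by rw [h8]⟩
    · exact ⟨-2 ^ k, by rw [h8]; ring⟩
    · exact ⟨0, by ring⟩
  · obtain ⟨k, x, y, z, w, h, hk⟩ := exists_hasAddRep_four_pow H n hn
    exact ⟨x, y, z, w, h, k, hk⟩
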